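/- Let $M$ be a compact connected smooth manifold (without boundary), let $\pi\colon X\to M$ be a smooth principal $S^1$-bundle with action $r_\theta\colon X\to X$, and let $Z=\partial/\partial\theta$ be the generator of the action. Let $G=N^2\,\alpha\otimes\alpha+\pi^*g$ be a bundle (Kaluza–Klein) metric on $X$, where $g$ is a Riemannian metric on $M$, $\alpha$ is a connection $1$-form (a smooth $S^1$-invariant $1$-form with $\alpha(Z)=1$), and $N>0$ is a constant. Let $m\in\mathbb Z\setminus\{0\}$ and let $\phi\colon X\to\mathbb C$ be an equivariant eigenfunction of weight $m$, that is, a smooth function, not identically zero, with $$\phi(r_\theta x)=e^{im\theta}\phi(x)\quad\text{for all }\theta,\,x,\qquad \Delta_G\phi=-\lambda^2\phi\quad\text{for some }\lambda\in\mathbb R,$$ where $\Delta_G$ is the Laplace–Beltrami operator of $G$. Let $L^m\to M$ be the complex line bundle associated with $X$, obtained from $X\times\mathbb C$ by identifying $(x,w)$ with $(r_\theta x,e^{im\theta}w)$, and let $s$ be the section of $L^m$ corresponding to $\phi$, given by $s(\pi(x))=[x,\phi(x)]$. Suppose that $0\in\mathbb C$ is a regular value of $\phi\colon X\to\mathbb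 C$ and that $s(z_0)=0$ for some $z_0\in M$. Then the nodal set $\mathcal N=\{x\in X:\operatorname{Re}\phi(x)=0\}$ is a connected smooth embedded hypersurface of $X$, and its complement $X\setminus\mathcal N$ has exactly two connected components. -/

import Mathlib

open Set Bundle
open scoped Manifold ContDiff Topology

noncomputable section

namespace CircleBundle

/-! ### Laplacian of a Riemannian metric -/

section Laplacian

variable {d : ℕ} {X : Type*} [TopologicalSpace X] [ChartedSpace (EuclideanSpace ℝ (Fin d)) X]
  [IsManifold (𝓡 d) ∞ X]

/-- Smooth Riemannian metrics on a `d`-dimensional manifold. -/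
abbrev RMetric (d : ℕ) (X : Type*) [TopologicalSpace X]
    [ChartedSpace (EuclideanSpace ℝ (Fin d)) X] [IsManifold (𝓡 d) ∞ X] :=
  ContMDiffRiemannianMetric (𝓡 d) ∞ (EuclideanSpace ℝ (Fin d))
    (fun x : X ↦ TangentSpace (𝓡 d) x)

/-- The `i`-th coordinate vector. -/
def coordVec (i : Fin d) : EuclideanSpace ℝ (Fin d) := EuclideanSpace.single i 1

/-- The matrix `G_{ij}` of the metric in the preferred chart at `x`, as a function of the
coordinates `y` in the target of that chart. -/
def gram (G : RMetric d X) (x : X) (y : EuclideanSpace ℝ (Fin d)) : Matrix (Fin d) (Fin d) ℝ :=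
  Matrix.of fun i j ↦ G.inner ((extChartAt (𝓡 d) x).symm y)
    (mfderiv (𝓡 d) (𝓡 d) (extChartAt (𝓡 d) x).symm y (coordVec i))
    (mfderiv (𝓡 d) (𝓡 d) (extChartAt (𝓡 d) x).symm y (coordVec j))

/-- The Laplace-Beltrami operator `Δ_G` (with the analysts' sign) on complex functions:
`Δ_G f = |G|^{-1/2} ∑ᵢ ∂ᵢ (∑ⱼ |G|^{1/2} G^{ij} ∂ⱼ f)` in coordinates. -/
def laplacian (G : RMetric d X) (f : X → ℂ) (x : X) : ℂ :=
  (Real.sqrt (gram G x (extChartAt (𝓡 d) x x)).det)⁻¹ •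
    ∑ i, fderiv ℝ (fun y ↦ ∑ j, (Real.sqrt (gram G x y).det * (gram G x y)⁻¹ i j) •
        fderiv ℝ (f ∘ (extChartAt (𝓡 d) x).symm) y (coordVec j))
      (extChartAt (𝓡 d) x x) (coordVec i)

end Laplacian

/-! ### Embedded hypersurfaces and regular values -/

section Hypersurface

/-- `S` is a smooth embedded hypersurface of the `(n+1)`-dimensional manifold `X`: near each of its
points there is a smooth chart of `X` in which `S` is the slice where the last coordinate
vanishes. -/
def IsEmbeddedHypersurface (n : ℕ) {X : Type*} [TopologicalSpace X]
    [ChartedSpace (EuclideanSpace ℝ (Fin (n + 1))) X] (S : Set X) : Prop :=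
  ∀ x ∈ S, ∃ e ∈ IsManifold.maximalAtlas (𝓡 (n + 1)) ∞ X, x ∈ e.source ∧
    ∀ p ∈ e.source, p ∈ S ↔ e p (Fin.last n) = 0

/-- `0 ∈ ℂ` is a regular value of `φ : X → ℂ`. -/
def ZeroIsRegularValue (d : ℕ) {X : Type*} [TopologicalSpace X]
    [ChartedSpace (EuclideanSpace ℝ (Fin d)) X] (φ : X → ℂ) : Prop :=
  ∀ x, φ x = 0 → Function.Surjective (mfderiv (𝓡 d) 𝓘(ℝ, ℂ) φ x)

/-- The nodal set of the real part of `φ`. -/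
def nodalSet {X : Type*} (φ : X → ℂ) : Set X := {x | (φ x).re = 0}

end Hypersurface

/-! ### Principal circle bundles, connections, bundle metrics -/

section Bundle

variable {n : ℕ}
  {M : Type*} [TopologicalSpace M] [ChartedSpace (EuclideanSpace ℝ (Fin n)) M]
  {X : Type*} [TopologicalSpace X] [ChartedSpace (EuclideanSpace ℝ (Fin (n + 1))) X]
  [MulAction Circle X]

/-- `pr : X → M` with the given action of the circle on `X` is a smooth principal circle bundle over
the `n`-dimensional manifold `M`. -/
structure IsPrincipal (n : ℕ)
    {M : Type*} [TopologicalSpace M] [ChartedSpace (EuclideanSpace ℝ (Fin n)) M]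
    {X : Type*} [TopologicalSpace X] [ChartedSpace (EuclideanSpace ℝ (Fin (n + 1))) X]
    [MulAction Circle X] (pr : X → M) : Prop where
  smooth_action : ContMDiff ((𝓡 1).prod (𝓡 (n + 1))) (𝓡 (n + 1)) ∞
    (fun p : Circle × X ↦ p.1 • p.2)
  smooth_proj : ContMDiff (𝓡 (n + 1)) (𝓡 n) ∞ pr
  proj_smul : ∀ (a : Circle) (x : X), pr (a • x) = pr x
  locally_trivial : ∀ z : M, ∃ e : Trivialization Circle pr, z ∈ e.baseSet ∧
    ContMDiffOn (𝓡 (n + 1)) ((𝓡 n).prod (𝓡 1)) ∞ e e.source ∧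
    ContMDiffOn ((𝓡 n).prod (𝓡 1)) (𝓡 (n + 1)) ∞ e.toOpenPartialHomeomorph.symm e.target ∧
    ∀ (a : Circle), ∀ x ∈ e.source, (e (a • x)).2 = a * (e x).2

/-- The generator `Z = ∂/∂θ` of the circle action. -/
def generator (n : ℕ) {X : Type*} [TopologicalSpace X]
    [ChartedSpace (EuclideanSpace ℝ (Fin (n + 1))) X] [MulAction Circle X] (x : X) :
    TangentSpace (𝓡 (n + 1)) x :=
  mfderiv 𝓘(ℝ, ℝ) (𝓡 (n + 1)) (fun θ : ℝ ↦ Circle.exp θ • x) 0 (1 : ℝ)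

/-- `α` is a connection 1-form: a smooth circle-invariant 1-form on `X` with `α(Z) = 1`. -/
structure IsConnectionForm [IsManifold (𝓡 (n + 1)) ∞ X]
    (α : ∀ x : X, TangentSpace (𝓡 (n + 1)) x →L[ℝ] ℝ) : Prop where
  smooth : ContMDiff (𝓡 (n + 1))
    ((𝓡 (n + 1)).prod 𝓘(ℝ, EuclideanSpace ℝ (Fin (n + 1)) →L[ℝ] ℝ)) ∞
    (fun x ↦ TotalSpace.mk' (EuclideanSpace ℝ (Fin (n + 1)) →L[ℝ] ℝ) x (α x))
  invariant : ∀ (a : Circle) (x : X) (v : TangentSpace (𝓡 (n + 1)) x),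
    α (a • x) (mfderiv (𝓡 (n + 1)) (𝓡 (n + 1)) (fun y : X ↦ a • y) x v) = α x v
  apply_generator : ∀ x, α x (generator n x) = 1

/-- `G` is the bundle (Kaluza-Klein) metric `N² α ⊗ α + pr^* g`. -/
def IsBundleMetric [IsManifold (𝓡 n) ∞ M] [IsManifold (𝓡 (n + 1)) ∞ X] (pr : X → M)
    (N : ℝ) (α : ∀ x : X, TangentSpace (𝓡 (n + 1)) x →L[ℝ] ℝ) (g : RMetric n M)
    (G : RMetric (n + 1) X) : Prop :=
  ∀ (x : X) (v w : TangentSpace (𝓡 (n + 1)) x), G.inner x v w = N ^ 2 * (α x v * α x w) +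
    g.inner (pr x) (mfderiv (𝓡 (n + 1)) (𝓡 n) pr x v) (mfderiv (𝓡 (n + 1)) (𝓡 n) pr x w)

/-- `φ` is an equivariant eigenfunction of weight `m` of `Δ_G`: a smooth, not identically zero
function with `φ(r_θ x) = e^{imθ} φ(x)` and `Δ_G φ = -λ² φ` for some real `λ`. -/
structure IsEquivariantEigenfunction [IsManifold (𝓡 (n + 1)) ∞ X] (G : RMetric (n + 1) X)
    (m : ℤ) (φ : X → ℂ) : Prop where
  smooth : ContMDiff (𝓡 (n + 1)) 𝓘(ℝ, ℂ) ∞ φ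
  ne_zero : φ ≠ 0
  equivariant : ∀ (a : Circle) (x : X), φ (a • x) = (a : ℂ) ^ m * φ x
  eigen : ∃ l : ℝ, ∀ x, laplacian G φ x = -((l : ℂ) ^ 2) * φ x

theorem IsPrincipal.surjective {pr : X → M} (h : IsPrincipal n pr) : Function.Surjective pr := by
  intro z
  obtain ⟨e, hz, -⟩ := h.locally_trivial z
  exact ⟨e.toOpenPartialHomeomorph.symm (z, 1), e.proj_symm_apply' hz⟩

theorem IsPrincipal.exists_smul_eq {pr : X → M} (h : IsPrincipal n pr) {x y : X}
    (hxy : pr x = pr y) : ∃ a : Circle, a • x = y := by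
  obtain ⟨e, hz, -, -, he⟩ := h.locally_trivial (pr y)
  have hy : y ∈ e.source := e.mem_source.2 hz
  have hx : x ∈ e.source := e.mem_source.2 (hxy ▸ hz)
  refine ⟨(e y).2 * ((e x).2)⁻¹, ?_⟩
  have hax : ((e y).2 * ((e x).2)⁻¹) • x ∈ e.source :=
    e.mem_source.2 (by rw [h.proj_smul]; exact e.mem_source.1 hx)
  apply e.injOn hax hy
  refine Prod.ext ?_ ?_
  · exact (e.coe_fst hax).trans ((h.proj_smul _ _).trans (hxy.trans (e.coe_fst hy).symm))
  · exact (he _ _ hx).trans (by simp)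

end Bundle

/-! ### The associated line bundles `L^m` -/

section LineBundle

/-- The relation `(x, w) ~ (a x, a^m w)` on `X × ℂ`. -/
def lineSetoid (X : Type*) [MulAction Circle X] (m : ℤ) : Setoid (X × ℂ) where
  r p q := ∃ a : Circle, a • p.1 = q.1 ∧ (a : ℂ) ^ m * p.2 = q.2
  iseqv :=
    { refl := fun p ↦ ⟨1, by simp⟩
      symm := by
        rintro p q ⟨a, h1, h2⟩
        refine ⟨a⁻¹, by rw [← h1, inv_smul_smul], ?_⟩
        rw [← h2, ← mul_assoc, Circle.coe_inv, ← mul_zpow, inv_mul_cancel₀ a.coe_ne_zero,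
          one_zpow, one_mul]
      trans := by
        rintro p q r ⟨a, h1, h2⟩ ⟨b, h3, h4⟩
        refine ⟨b * a, by rw [mul_smul, h1, h3], ?_⟩
        rw [← h4, ← h2, ← mul_assoc, Circle.coe_mul, mul_zpow] }

/-- The total space of `L^m`, the complex line bundle associated with the principal bundle `X` and
the `m`-th character. The convention is the one in which `X` is the unit circle bundle of the dual
of `L` and `[x, w]` is the vector `v` of `L^m` with `x^{⊗ m}(v) = w`, so that functions of weight `m`
on `X` are sections of `L^m`. -/
def LineBundle (X : Type*) [MulAction Circle X] (m : ℤ) : Type _ := Quotient (lineSetoid X m)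

/-- The vector `[x, w]` of `L^m`. -/
def LineBundle.mk {X : Type*} [MulAction Circle X] (m : ℤ) (x : X) (w : ℂ) : LineBundle X m :=
  Quotient.mk (lineSetoid X m) (x, w)

variable {n : ℕ}
  {M : Type*} [TopologicalSpace M] [ChartedSpace (EuclideanSpace ℝ (Fin n)) M]
  {X : Type*} [TopologicalSpace X] [ChartedSpace (EuclideanSpace ℝ (Fin (n + 1))) X]
  [MulAction Circle X] {pr : X → M}

/-- The section `pr x ↦ [x, φ x]` of `L^m` associated with a function `φ` of weight `m`; by
`assocSection_proj` it does not depend on the choice of `x` in the fibre. -/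
def assocSection (h : IsPrincipal n pr) (m : ℤ) (φ : X → ℂ) (z : M) : LineBundle X m :=
  LineBundle.mk m (Function.surjInv h.surjective z) (φ (Function.surjInv h.surjective z))

theorem assocSection_proj (h : IsPrincipal n pr) (m : ℤ) (φ : X → ℂ)
    (hφ : ∀ (a : Circle) (x : X), φ (a • x) = (a : ℂ) ^ m * φ x) (x : X) :
    assocSection h m φ (pr x) = LineBundle.mk m x (φ x) := by
  obtain ⟨a, ha⟩ := h.exists_smul_eq (Function.surjInv_eq h.surjective (pr x))
  refine Quotient.sound ⟨a, ha, ?_⟩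
  simp only
  rw [← hφ, ha]

/-- The zero section of `L^m`. -/
def zeroLineSection (h : IsPrincipal n pr) (m : ℤ) : M → LineBundle X m :=
  assocSection h m (fun _ ↦ 0)

end LineBundle

end CircleBundle

end

open CircleBundle

namespace CircleBundle

/-! Everything about connectedness follows from one fact: if D ⊆ ℂ is a convex cone with a nonzero
element, then P = φ⁻¹(D) is connected. The imaginary axis gives the nodal set, and the two open
half-planes give the components of its complement.

To prove the fact, let C be a component of P (`IsPrincipal.isConnected_preimage_cone`). The closure
of C projects onto a clopen subset of M, hence onto M. Closedness comes from compactness of the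
circle. For openness away from zeros, since m ≠ 0 a local section can be rotated until φ has
constant phase along it, and C spreads along this section. At a zero, φ is a submersion, so P is
locally connected there, and connectedness of the circle makes C contain all of P near the whole
fibre. Applied over z₀, every component contains P near the same fibre, so there is only one.

Smoothness of the nodal set: at zeros of φ use regularity; elsewhere use dφ(Z) = imφ, whose real
part is nonzero where φ is imaginary and nonzero. -/

/-- Rotating by an `m`-th root of the inverse phase makes a complex number real and nonnegative. -/
theorem exp_neg_arg_div_zpow_mul {m : ℤ} (hm : m ≠ 0) (q : ℂ) :
    (Circle.exp (-q.arg / m) : ℂ) ^ m * q = ‖q‖ := by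
  have hm' : (m : ℂ) ≠ 0 := Int.cast_ne_zero.2 hm
  have h : (Circle.exp (-q.arg / m) : ℂ) ^ m = Complex.exp (-(q.arg * Complex.I)) := by
    rw [Circle.coe_exp, ← Complex.exp_int_mul]
    congr 1
    push_cast
    field_simp
  conv_lhs => rw [h, ← Complex.norm_mul_exp_arg_mul_I q]
  rw [mul_left_comm, Complex.norm_mul_exp_arg_mul_I, ← Complex.exp_add]
  simp

/-- Since m ≠ 0, every phase is an m-th power on the circle. Hence each orbit of the action meets
the preimage of any prescribed closed ray. -/
theorem exists_zpow_mul_eq_smul {m : ℤ} (hm : m ≠ 0) (w : ℂ) {d : ℂ} (hd : d ≠ 0) :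
    ∃ (a : Circle) (r : ℝ), 0 ≤ r ∧ (a : ℂ) ^ m * w = r • d := by
  refine ⟨Circle.exp (-(w / d).arg / m), ‖w / d‖, norm_nonneg _, ?_⟩
  rw [Complex.real_smul, ← exp_neg_arg_div_zpow_mul hm (w / d), mul_assoc, div_mul_cancel₀ _ hd]

/-! ### Connectedness of preimages of cones -/

section Topology

variable {n : ℕ}
  {M : Type*} [TopologicalSpace M] [ChartedSpace (EuclideanSpace ℝ (Fin n)) M]
  {X : Type*} [TopologicalSpace X] [ChartedSpace (EuclideanSpace ℝ (Fin (n + 1))) X]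
  [MulAction Circle X] {pr : X → M}

theorem IsPrincipal.continuousSMul (h : IsPrincipal n pr) : ContinuousSMul Circle X :=
  ⟨h.smooth_action.continuous⟩

theorem IsPrincipal.isOpenMap (h : IsPrincipal n pr) : IsOpenMap pr := by
  refine IsOpenMap.of_nhds_le fun x ↦ ?_
  obtain ⟨e, hz, -⟩ := h.locally_trivial (pr x)
  exact (e.map_proj_nhds (e.mem_source.2 hz)).ge

/-- Near the image of a point `x` where a function of weight `m` does not vanish there is a section
along which the phase of the function is constant. -/
theorem IsPrincipal.exists_section_pos_smul (h : IsPrincipal n pr) {m : ℤ} (hm : m ≠ 0)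
    {φ : X → ℂ} (hφc : Continuous φ)
    (hφ : ∀ (a : Circle) (x : X), φ (a • x) = (a : ℂ) ^ m * φ x) {x : X} (hx : φ x ≠ 0) :
    ∃ V ∈ 𝓝 (pr x), IsPreconnected V ∧ ∃ (τ : M → X) (c : ℂ), ContinuousOn τ V ∧
      ∀ w ∈ V, pr (τ w) = w ∧ ∃ r : ℝ, 0 < r ∧ φ (τ w) = r • c := by
  have := h.continuousSMul
  have : LocallyConnectedSpace M :=
    ChartedSpace.locallyConnectedSpace (EuclideanSpace ℝ (Fin n)) M
  obtain ⟨e, hz, -⟩ := h.locally_trivial (pr x)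
  set σ : M → X := fun w ↦ e.toOpenPartialHomeomorph.symm (w, 1) with hσ
  have hprσ : ∀ w ∈ e.baseSet, pr (σ w) = w := fun w hw ↦ e.proj_symm_apply' hw
  have hσc : ContinuousOn σ e.baseSet := by
    refine e.toOpenPartialHomeomorph.continuousOn_symm.comp (by fun_prop) fun w hw ↦ ?_
    exact e.mem_target.2 hw
  set c := φ (σ (pr x)) with hc
  have hc0 : c ≠ 0 := by
    obtain ⟨a, ha⟩ := h.exists_smul_eq (hprσ _ hz)
    rintro h0
    apply hx
    rw [← ha, hφ, ← hc, h0, mul_zero]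
  have hqc : ContinuousOn (fun w ↦ φ (σ w) / c) e.baseSet :=
    (hφc.comp_continuousOn hσc).div_const _
  -- On the slit plane `arg` is continuous, so the correcting angle `-arg / m` is continuous over
  -- this neighbourhood.
  have hO : e.baseSet ∩ (fun w ↦ φ (σ w) / c) ⁻¹' Complex.slitPlane ∈ 𝓝 (pr x) :=
    (hqc.isOpen_inter_preimage e.open_baseSet Complex.isOpen_slitPlane).mem_nhds
      ⟨hz, by simp [← hc, hc0]⟩
  obtain ⟨V, hVO, hV, hxV, hVc⟩ := locallyConnectedSpace_iff_subsets_isOpen_isConnected.1 ‹_› _ _ hO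
  refine ⟨V, hV.mem_nhds hxV, hVc.isPreconnected,
    fun w ↦ Circle.exp (-(φ (σ w) / c).arg / m) • σ w, c, ?_, fun w hw ↦ ⟨?_, ‖φ (σ w) / c‖, ?_, ?_⟩⟩
  · refine ContinuousOn.smul (Circle.exp.continuous.comp_continuousOn
      (ContinuousOn.div_const (ContinuousOn.neg ?_) _)) (hσc.mono fun w hw ↦ (hVO hw).1)
    exact fun w hw ↦ ContinuousAt.comp_continuousWithinAt (f := fun w ↦ φ (σ w) / c)
      (Complex.continuousAt_arg (hVO hw).2) ((hqc.mono fun w hw ↦ (hVO hw).1) w hw)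
  · rw [h.proj_smul, hprσ _ (hVO hw).1]
  · exact norm_pos_iff.2 (Complex.slitPlane_ne_zero (hVO hw).2)
  · rw [hφ, Complex.real_smul, ← exp_neg_arg_div_zpow_mul hm (φ (σ w) / c), mul_assoc,
      div_mul_cancel₀ _ hc0]

/-- Away from the zeros of a function of weight `m`, a component of the preimage of a cone that
meets the part over a small set projects onto this small set. -/
theorem IsPrincipal.exists_nhds_subset_image_connectedComponentIn (h : IsPrincipal n pr) {m : ℤ}
    (hm : m ≠ 0) {φ : X → ℂ} (hφc : Continuous φ)
    (hφ : ∀ (a : Circle) (x : X), φ (a • x) = (a : ℂ) ^ m * φ x) {x : X} (hx : φ x ≠ 0)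
    {D : Set ℂ} (hD : ∀ r : ℝ, 0 < r → ∀ w ∈ D, r • w ∈ D) :
    ∃ V ∈ 𝓝 (pr x), ∀ p, pr p ∈ V → φ p ∈ D →
      V ⊆ pr '' connectedComponentIn (φ ⁻¹' D) p := by
  have := h.continuousSMul
  obtain ⟨V, hV, hVc, τ, c, hτ, hτV⟩ := h.exists_section_pos_smul hm hφc hφ hx
  refine ⟨V, hV, fun p hp hpD ↦ ?_⟩
  obtain ⟨b, hb⟩ := h.exists_smul_eq (hτV _ hp).1
  obtain ⟨s, hs, hs'⟩ := (hτV _ hp).2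
  -- The translate of τ by b passes through p, and φ along it is a positive multiple of φ p, so it
  -- stays in the cone.
  have hsub : (fun w ↦ b • τ w) '' V ⊆ connectedComponentIn (φ ⁻¹' D) p := by
    refine (hVc.image _ (hτ.const_smul b)).subset_connectedComponentIn ⟨_, hp, hb⟩ ?_
    rintro _ ⟨w, hw, rfl⟩
    obtain ⟨r, hr, hr'⟩ := (hτV w hw).2
    have : φ (b • τ w) = (r / s) • φ p := by
      rw [← hb, hφ, hφ, hr', hs']
      simp only [Complex.real_smul, Complex.ofReal_div]
      field_simp [hs.ne']
    change φ (b • τ w) ∈ D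
    rw [this]
    exact hD _ (div_pos hr hs) _ hpD
  intro w hw
  exact ⟨b • τ w, hsub ⟨w, hw, rfl⟩, by rw [h.proj_smul, (hτV w hw).1]⟩

/-- If a function of weight `m ≠ 0` on a principal circle bundle over a connected base is a
topological submersion at its zeros and has a zero, the preimage of a convex cone is connected. -/
theorem IsPrincipal.isConnected_preimage_cone [ConnectedSpace M] (h : IsPrincipal n pr) {m : ℤ}
    (hm : m ≠ 0) {φ : X → ℂ} (hφc : Continuous φ)
    (hφ : ∀ (a : Circle) (x : X), φ (a • x) = (a : ℂ) ^ m * φ x)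
    {D : Set ℂ} (hD : ∀ r : ℝ, 0 < r → ∀ w ∈ D, r • w ∈ D) {d : ℂ} (hd : d ∈ D) (hd0 : d ≠ 0)
    (hsub : ∀ x, φ x = 0 → (𝓝 (0 : ℂ) ≤ (𝓝 x).map φ) ∧
      ∃ U : Set X, IsOpen U ∧ x ∈ U ∧ IsPreconnected (U ∩ φ ⁻¹' D))
    {x₀ : X} (hx₀ : φ x₀ = 0) : IsConnected (φ ⁻¹' D) := by
  have := h.continuousSMul
  have hconn : PreconnectedSpace Circle := by
    have hs : Function.Surjective Circle.exp := fun a ↦ ⟨_, Circle.exp_arg a⟩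
    exact ⟨hs.range_eq ▸ isPreconnected_range Circle.exp.continuous⟩
  set P := φ ⁻¹' D with hP
  have h0D : (0 : ℂ) ∈ closure D := by
    have hlim : Filter.Tendsto (fun r : ℝ ↦ r • d) (𝓝[>] 0) (𝓝 0) := by
      have : ContinuousWithinAt (fun r : ℝ ↦ r • d) (Ioi 0) 0 := by fun_prop
      simpa [ContinuousWithinAt] using this
    exact mem_closure_of_tendsto hlim (eventually_mem_nhdsWithin.mono fun r hr ↦ hD r hr d hd)
  have hzero_closure : ∀ x, φ x = 0 → x ∈ closure P := by
    intro x hx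
    rw [mem_closure_iff_nhds]
    intro t ht
    obtain ⟨_, ⟨y, hy, rfl⟩, hyD⟩ := mem_closure_iff_nhds.1 h0D _
      ((hsub x hx).1 (Filter.image_mem_map ht))
    exact ⟨y, hy, hyD⟩
  have hrot : ∀ x, ∃ a : Circle, a • x ∈ closure P := by
    intro x
    obtain ⟨a, r, hr, har⟩ := exists_zpow_mul_eq_smul hm (φ x) hd0
    refine ⟨a, ?_⟩
    rcases hr.eq_or_lt with rfl | hr
    · exact hzero_closure _ (by rw [hφ, har, zero_smul])
    · refine subset_closure ?_
      rw [hP, mem_preimage, hφ, har]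
      exact hD r hr d hd
  have hφ0 : ∀ (a : Circle) {x : X}, φ x = 0 → φ (a • x) = 0 := fun a x hx ↦ by
    rw [hφ, hx, mul_zero]
  -- a component adherent to one zero contains all of `P` near the fibre of this zero
  have hfibre : ∀ p ∈ P, ∀ x, φ x = 0 → x ∈ closure (connectedComponentIn P p) →
      ∃ O : Set X, IsOpen O ∧ (∀ a : Circle, a • x ∈ O) ∧ O ∩ P ⊆ connectedComponentIn P p := by
    intro p hp x hx hxC
    set C := connectedComponentIn P p
    choose! U hUo hxU hUc using fun x hx ↦ (hsub x hx).2
    have key : ∀ y, φ y = 0 → y ∈ closure C → U y ∩ P ⊆ C := by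
      intro y hy hyC
      obtain ⟨q, hqU, hqC⟩ := mem_closure_iff.1 hyC _ (hUo y hy) (hxU y hy)
      have hqP := connectedComponentIn_subset _ _ hqC
      have := (hUc y hy).subset_connectedComponentIn ⟨hqU, hqP⟩ inter_subset_right
      rwa [← connectedComponentIn_eq hqC] at this
    have hcont : Continuous fun a : Circle ↦ a • x := by fun_prop
    -- Openness: near a • x, the zeros b • x lie in the closure of P ∩ U, which by `key` lies in the
    -- closure of C. The circle is connected, so the whole fibre is adherent to C.
    have hS : {a : Circle | a • x ∈ closure C} = univ := by
      refine IsClopen.eq_univ ⟨isClosed_closure.preimage hcont, ?_⟩ ⟨1, by simpa using hxC⟩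
      rw [isOpen_iff_mem_nhds]
      intro a ha
      filter_upwards [((hUo _ (hφ0 a hx)).preimage hcont).mem_nhds (hxU _ (hφ0 a hx))] with b hb
      have hbP := hzero_closure _ (hφ0 b hx)
      exact closure_mono (key _ (hφ0 a hx) ha)
        ((hUo _ (hφ0 a hx)).inter_closure ⟨hb, hbP⟩)
    refine ⟨⋃ a : Circle, U (a • x), isOpen_iUnion fun a ↦ hUo _ (hφ0 a hx),
      fun a ↦ mem_iUnion.2 ⟨a, hxU _ (hφ0 a hx)⟩, ?_⟩
    rintro q ⟨hq, hqP⟩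
    obtain ⟨a, ha⟩ := mem_iUnion.1 hq
    exact key _ (hφ0 a hx) (hS.ge (mem_univ a)) ⟨ha, hqP⟩
  -- the closure of every component of `P` projects onto the base
  have hsurj : ∀ p ∈ P, pr '' closure (connectedComponentIn P p) = univ := by
    intro p hp
    set C := connectedComponentIn P p with hC
    refine IsClopen.eq_univ ⟨?_, ?_⟩ ⟨pr p, p, subset_closure (mem_connectedComponentIn hp), rfl⟩
    · rw [← (h.isOpenMap.isQuotientMap h.smooth_proj.continuous h.surjective).isClosed_preimage]
      convert (isClosed_closure (s := C)).smul_left_of_isCompact (isCompact_univ (X := Circle))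
        using 1
      ext x
      constructor
      · rintro ⟨y, hy, hyx⟩
        obtain ⟨a, rfl⟩ := h.exists_smul_eq hyx
        exact smul_mem_smul (mem_univ a) hy
      · rintro ⟨a, -, y, hy, rfl⟩
        exact ⟨y, hy, (h.proj_smul a y).symm⟩
    · rw [isOpen_iff_mem_nhds]
      rintro _ ⟨x, hxC, rfl⟩
      by_cases hx : φ x = 0
      · obtain ⟨O, hO, hxO, hOC⟩ := hfibre p hp x hx hxC
        -- W is a neighbourhood of x with all its rotations in O. Each of its points can be rotated
        -- into the closure of P, and so into the closure of C.
        obtain ⟨A, W, -, hW, hA, hxW, hAW⟩ := generalized_tube_lemma (isCompact_univ (X := Circle))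
          (isCompact_singleton (x := x)) (hO.preimage (continuous_smul (M := Circle) (X := X)))
          (by rintro ⟨a, y⟩ ⟨-, rfl⟩; exact hxO a)
        refine Filter.mem_of_superset (h.isOpenMap.image_mem_nhds
          (hW.mem_nhds (hxW (mem_singleton x)))) ?_
        rintro _ ⟨y, hy, rfl⟩
        obtain ⟨a, ha⟩ := hrot y
        have haO : a • y ∈ O := hAW (mk_mem_prod (hA (mem_univ a)) hy)
        exact ⟨a • y, closure_mono hOC (hO.inter_closure ⟨haO, ha⟩), h.proj_smul a y⟩
      · obtain ⟨V, hV, hVC⟩ := h.exists_nhds_subset_image_connectedComponentIn hm hφc hφ hx hD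
        obtain ⟨q, hqV, hqC⟩ := mem_closure_iff_nhds.1 hxC _
          (h.smooth_proj.continuous.continuousAt.preimage_mem_nhds hV)
        have := hVC q hqV (connectedComponentIn_subset P p hqC)
        rw [← hP, ← connectedComponentIn_eq hqC] at this
        exact Filter.mem_of_superset hV (this.trans (image_mono subset_closure))
  have hmeet : ∀ p ∈ P, ∃ O : Set X, IsOpen O ∧ x₀ ∈ O ∧ O ∩ P ⊆ connectedComponentIn P p := by
    intro p hp
    obtain ⟨x, hxC, hx⟩ := (hsurj p hp).ge (mem_univ (pr x₀))
    obtain ⟨a, ha⟩ := h.exists_smul_eq hx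
    have hx0 : φ x = 0 := by
      rw [← inv_smul_eq_iff.2 ha.symm]
      exact hφ0 _ hx₀
    obtain ⟨O, hO, hxO, hOC⟩ := hfibre p hp x hx0 hxC
    exact ⟨O, hO, ha ▸ hxO a, hOC⟩
  obtain ⟨p, hp⟩ : P.Nonempty := closure_nonempty_iff.1 ⟨x₀, hzero_closure _ hx₀⟩
  refine ⟨⟨p, hp⟩, isPreconnected_of_forall p fun q hq ↦
    ⟨connectedComponentIn P p, connectedComponentIn_subset _ _, mem_connectedComponentIn hp, ?_,
      isPreconnected_connectedComponentIn⟩⟩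
  obtain ⟨O₁, hO₁, hx₁, hOC₁⟩ := hmeet p hp
  obtain ⟨O₂, hO₂, hx₂, hOC₂⟩ := hmeet q hq
  -- Both components contain P near x₀, and x₀ is adherent to P, so they share a point.
  obtain ⟨y, ⟨hy₁, hy₂⟩, hyP⟩ := mem_closure_iff.1 (hzero_closure _ hx₀) _ (hO₁.inter hO₂) ⟨hx₁, hx₂⟩
  rw [connectedComponentIn_eq (hOC₁ ⟨hy₁, hyP⟩), ← connectedComponentIn_eq (hOC₂ ⟨hy₂, hyP⟩)]
  exact mem_connectedComponentIn hq

end Topology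

/-! ### Counting components by sign -/

/-- The complement of the zero set of a continuous real function has two components if the two sets
where the function is positive and negative are connected. -/
theorem card_connectedComponents_ne_zero {X : Type*} [TopologicalSpace X] {f : X → ℝ}
    (hf : Continuous f) (hpos : IsConnected {x | 0 < f x}) (hneg : IsConnected {x | f x < 0}) :
    Nat.card (ConnectedComponents ↥{x | f x = 0}ᶜ) = 2 := by
  set Y := ↥({x | f x = 0}ᶜ)
  let F : Y → Bool := fun y ↦ decide (0 < f y)
  have hF : Continuous F := by
    have h1 : IsOpen (F ⁻¹' {true}) := by
      have : F ⁻¹' {true} = {y : Y | 0 < f y} := by ext; simp [F]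
      rw [this]
      exact isOpen_lt continuous_const (hf.comp continuous_subtype_val)
    have h2 : IsOpen (F ⁻¹' {false}) := by
      have : F ⁻¹' {false} = {y : Y | f y < 0} := by
        ext y
        have : f y ≠ 0 := y.2
        simp [F, le_iff_lt_or_eq, this]
      rw [this]
      exact isOpen_lt (hf.comp continuous_subtype_val) continuous_const
    refine continuous_discrete_rng.2 fun b ↦ ?_
    cases b
    exacts [h2, h1]
  have hpre : ∀ s : Set X, IsPreconnected s → s ⊆ {x | f x = 0}ᶜ →
      IsPreconnected ((↑) ⁻¹' s : Set Y) := fun s hs hsub ↦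
    hs.preimage_of_isOpenMap Subtype.val_injective
      ((isClosed_eq hf continuous_const).isOpen_compl.isOpenMap_subtype_val) (hsub.trans Subtype.range_coe.ge)
  have hinj : Function.Injective hF.connectedComponentsLift := by
    intro a b
    obtain ⟨x, rfl⟩ := ConnectedComponents.surjective_coe a
    obtain ⟨y, rfl⟩ := ConnectedComponents.surjective_coe b
    rw [hF.connectedComponentsLift_apply_coe, hF.connectedComponentsLift_apply_coe]
    intro hxy
    rw [ConnectedComponents.coe_eq_coe']
    have hx : f x ≠ 0 := x.2
    have hy : f y ≠ 0 := y.2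
    have hxy' : 0 < f x ↔ 0 < f y := by simpa [F] using hxy
    rcases hx.lt_or_gt with h | h
    · exact (hpre _ hneg.isPreconnected fun z hz ↦ ne_of_lt hz).subset_connectedComponent
        (hy.lt_or_gt.resolve_right fun h' ↦ (hxy'.2 h').not_gt h) h
    · exact (hpre _ hpos.isPreconnected fun z hz ↦ ne_of_gt hz).subset_connectedComponent
        (hxy'.1 h) h
  have hsurj : Function.Surjective hF.connectedComponentsLift := by
    obtain ⟨x, hx⟩ := hpos.nonempty
    obtain ⟨y, hy⟩ := hneg.nonempty
    intro b
    cases b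
    · exact ⟨((⟨y, ne_of_lt hy⟩ : Y) : ConnectedComponents Y),
        decide_eq_false (not_lt.2 (le_of_lt hy))⟩
    · exact ⟨((⟨x, ne_of_gt hx⟩ : Y) : ConnectedComponents Y), decide_eq_true hx⟩
  rw [Nat.card_congr (Equiv.ofBijective _ ⟨hinj, hsurj⟩), Nat.card_eq_fintype_card,
    Fintype.card_bool]

/-! ### Local structure of submersions -/

/-- A submersion onto `F` is locally a projection, so that preimages of convex sets are locally
connected there. -/
theorem _root_.HasStrictFDerivAt.exists_isOpen_isPreconnected_inter_preimage
    {E F : Type*} [NormedAddCommGroup E] [NormedSpace ℝ E] [CompleteSpace E]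
    [NormedAddCommGroup F] [NormedSpace ℝ F] [FiniteDimensional ℝ F]
    {f : E → F} {f' : E →L[ℝ] F} {a : E} (hf : HasStrictFDerivAt f f' a)
    (hf' : Function.Surjective f') {O : Set E} (hO : O ∈ 𝓝 a) :
    ∃ U ⊆ O, IsOpen U ∧ a ∈ U ∧ ∀ D : Set F, Convex ℝ D → IsPreconnected (U ∩ f ⁻¹' D) := by
  have : CompleteSpace F := FiniteDimensional.complete ℝ F
  -- In this chart f is the first projection, so f⁻¹(D) inside a small ball becomes an intersection
  -- of convex sets.
  set Ψ := hf.implicitToOpenPartialHomeomorph f f' (LinearMap.range_eq_top.2 hf') with hΨ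
  have ha : a ∈ Ψ.source := hf.mem_implicitToOpenPartialHomeomorph_source _
  have hfst : ∀ y, (Ψ y).1 = f y := hf.implicitToOpenPartialHomeomorph_fst _
  have hN : Ψ.target ∩ Ψ.symm ⁻¹' O ∈ 𝓝 (Ψ a) :=
    Filter.inter_mem (Ψ.open_target.mem_nhds (Ψ.map_source ha))
      ((Ψ.continuousAt_symm (Ψ.map_source ha)).preimage_mem_nhds (by rwa [Ψ.left_inv ha]))
  obtain ⟨ε, hε, hball⟩ := Metric.mem_nhds_iff.1 hN
  set B := Metric.ball (Ψ a) ε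
  have himg : Ψ.source ∩ Ψ ⁻¹' B = Ψ.symm '' B := by
    rw [Ψ.symm_image_eq_source_inter_preimage fun y hy ↦ (hball hy).1]
  refine ⟨Ψ.source ∩ Ψ ⁻¹' B, ?_, Ψ.isOpen_inter_preimage Metric.isOpen_ball,
    ⟨ha, Metric.mem_ball_self hε⟩, fun D hD ↦ ?_⟩
  · rw [himg]
    rintro _ ⟨y, hy, rfl⟩
    exact (hball hy).2
  · have hconv : Convex ℝ (B ∩ Prod.fst ⁻¹' D) :=
      (convex_ball _ _).inter (hD.is_linear_preimage ⟨fun _ _ ↦ rfl, fun _ _ ↦ rfl⟩)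
    have hset : Ψ.source ∩ Ψ ⁻¹' B ∩ f ⁻¹' D = Ψ.symm '' (B ∩ Prod.fst ⁻¹' D) := by
      rw [himg]
      ext y
      constructor
      · rintro ⟨⟨w, hw, rfl⟩, hwD⟩
        refine ⟨w, ⟨hw, ?_⟩, rfl⟩
        rwa [mem_preimage, ← hfst, Ψ.right_inv (hball hw).1] at hwD
      · rintro ⟨w, ⟨hw, hwD⟩, rfl⟩
        refine ⟨⟨w, hw, rfl⟩, ?_⟩
        rwa [mem_preimage, ← hfst, Ψ.right_inv (hball hw).1]
    rw [hset]
    exact hconv.isPreconnected.image _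
      (Ψ.continuousOn_symm.mono fun y hy ↦ (hball hy.1).1)

section Manifold

variable {d : ℕ} {X : Type*} [TopologicalSpace X] [ChartedSpace (EuclideanSpace ℝ (Fin d)) X]
  {F : Type*} [NormedAddCommGroup F] [NormedSpace ℝ F]

/-- The derivative of a smooth function at `x` is its derivative in the preferred chart at `x`. -/
theorem mfderiv_eq_fderiv_comp_chartAt_symm {f : X → F} (hf : ContMDiff (𝓡 d) 𝓘(ℝ, F) ∞ f)
    (x : X) :
    mfderiv (𝓡 d) 𝓘(ℝ, F) f x =
      fderiv ℝ (f ∘ (chartAt (EuclideanSpace ℝ (Fin d)) x).symm)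
        (chartAt (EuclideanSpace ℝ (Fin d)) x x) := by
  rw [((hf x).mdifferentiableAt (by simp)).mfderiv]
  simp [writtenInExtChartAt, Function.comp_def, fderivWithin_univ, chartAt_self_eq]
  rfl

variable [IsManifold (𝓡 d) ∞ X]

/-- A smooth function read in the preferred chart at `x` is smooth. -/
theorem contDiffOn_comp_chartAt_symm {f : X → F} (hf : ContMDiff (𝓡 d) 𝓘(ℝ, F) ∞ f) (x : X) :
    ContDiffOn ℝ ∞ (f ∘ (chartAt (EuclideanSpace ℝ (Fin d)) x).symm)
      (chartAt (EuclideanSpace ℝ (Fin d)) x).target := by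
  rw [← contMDiffOn_iff_contDiffOn]
  exact hf.comp_contMDiffOn (contMDiffOn_chart_symm (I := 𝓡 d) (n := ∞))

theorem hasStrictFDerivAt_comp_chartAt_symm {f : X → F} (hf : ContMDiff (𝓡 d) 𝓘(ℝ, F) ∞ f)
    (x : X) :
    HasStrictFDerivAt (f ∘ (chartAt (EuclideanSpace ℝ (Fin d)) x).symm)
      (mfderiv (𝓡 d) 𝓘(ℝ, F) f x : EuclideanSpace ℝ (Fin d) →L[ℝ] F)
      (chartAt (EuclideanSpace ℝ (Fin d)) x x) := by
  rw [mfderiv_eq_fderiv_comp_chartAt_symm hf x]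
  exact ((contDiffOn_comp_chartAt_symm hf x).contDiffAt
    ((chartAt _ x).open_target.mem_nhds (mem_chart_target _ x))).hasStrictFDerivAt (by simp)

/-- Supplies both local conditions required at zeros by `IsPrincipal.isConnected_preimage_cone`:
openness of the map and local connectedness of the preimage. -/
theorem exists_isOpen_isPreconnected_inter_preimage [FiniteDimensional ℝ F]
    {f : X → F} (hf : ContMDiff (𝓡 d) 𝓘(ℝ, F) ∞ f) {x : X}
    (hx : Function.Surjective (mfderiv (𝓡 d) 𝓘(ℝ, F) f x)) :
    𝓝 (f x) ≤ (𝓝 x).map f ∧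
      ∃ U : Set X, IsOpen U ∧ x ∈ U ∧
        ∀ D : Set F, Convex ℝ D → IsPreconnected (U ∩ f ⁻¹' D) := by
  have : CompleteSpace F := FiniteDimensional.complete ℝ F
  set c := chartAt (EuclideanSpace ℝ (Fin d)) x
  have hs := hasStrictFDerivAt_comp_chartAt_symm hf x
  have hxc : x ∈ c.source := mem_chart_source _ x
  refine ⟨?_, ?_⟩
  · have h1 := hs.map_nhds_eq_of_surj (LinearMap.range_eq_top.2 hx)
    rw [← Filter.map_map, c.symm_map_nhds_eq hxc, Function.comp_apply, c.left_inv hxc] at h1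
    exact h1.ge
  · obtain ⟨U, hUc, hU, hxU, hUD⟩ := hs.exists_isOpen_isPreconnected_inter_preimage hx
      (c.open_target.mem_nhds (c.map_source hxc))
    refine ⟨c.source ∩ c ⁻¹' U, c.isOpen_inter_preimage hU, ⟨hxc, hxU⟩, fun D hD ↦ ?_⟩
    have : c.source ∩ c ⁻¹' U ∩ f ⁻¹' D = c.symm '' (U ∩ (f ∘ c.symm) ⁻¹' D) := by
      ext y
      constructor
      · rintro ⟨⟨hy, hyU⟩, hyD⟩
        exact ⟨c y, ⟨hyU, by simpa [c.left_inv hy] using hyD⟩, c.left_inv hy⟩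
      · rintro ⟨w, ⟨hwU, hwD⟩, rfl⟩
        exact ⟨⟨c.map_target (hUc hwU), by simpa [c.right_inv (hUc hwU)] using hwU⟩, hwD⟩
    rw [this]
    exact (hUD D hD).image _ (c.continuousOn_symm.mono fun y hy ↦ hUc hy.1)

end Manifold

/-! ### Slice charts for zero sets -/

/-- Two nonzero linear functionals have a common vector on which neither vanishes. -/
theorem exists_apply_eq_one_apply_ne_zero {E : Type*} [AddCommGroup E] [Module ℝ E]
    {l k : E →ₗ[ℝ] ℝ} (hl : l ≠ 0) (hk : k ≠ 0) : ∃ u, l u = 1 ∧ k u ≠ 0 := by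
  suffices ∃ u, l u ≠ 0 ∧ k u ≠ 0 by
    obtain ⟨u, h1, h2⟩ := this
    exact ⟨(l u)⁻¹ • u, by simp [h1], by simp [h1, h2]⟩
  obtain ⟨v, hv⟩ := DFunLike.ne_iff.1 hl
  obtain ⟨w, hw⟩ := DFunLike.ne_iff.1 hk
  simp only [LinearMap.zero_apply] at hv hw
  by_cases h1 : k v = 0
  · by_cases h2 : l w = 0
    · exact ⟨v + w, by simp [h2, hv], by simp [h1, hw]⟩
    · exact ⟨w, h2, hw⟩
  · exact ⟨v, hv, h1⟩

/-- A smooth real function with nonzero derivative can be completed to a local diffeomorphism whose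
composition with a given nonzero functional is this function. -/
theorem exists_mem_contDiffGroupoid_apply_eq {E : Type*} [NormedAddCommGroup E] [NormedSpace ℝ E]
    [FiniteDimensional ℝ E] {f : E → ℝ} {s : Set E} (hs : IsOpen s) (hf : ContDiffOn ℝ ∞ f s)
    {a : E} (ha : a ∈ s) (hf' : fderiv ℝ f a ≠ 0) {l : E →L[ℝ] ℝ} (hl : l ≠ 0) :
    ∃ Ψ ∈ contDiffGroupoid ∞ 𝓘(ℝ, E), a ∈ Ψ.source ∧ ∀ y, l (Ψ y) = f y := by
  have : CompleteSpace E := FiniteDimensional.complete ℝ E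
  obtain ⟨u, hlu, hfu⟩ := exists_apply_eq_one_apply_ne_zero
    (l := l.toLinearMap) (k := (fderiv ℝ f a).toLinearMap)
    (fun h0 ↦ hl (ContinuousLinearMap.coe_injective h0))
    (fun h0 ↦ hf' (ContinuousLinearMap.coe_injective h0))
  simp only [ContinuousLinearMap.coe_coe] at hlu hfu
  -- Since l u = 1, applying l to this correction of the identity gives exactly f. Its derivative at
  -- y is invertible as soon as df(u) ≠ 0 there.
  set Ψ₀ : E → E := fun y ↦ y + (f y - l y) • u with hΨ₀
  have hΨc : ContDiffOn ℝ ∞ Ψ₀ s :=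
    contDiffOn_id.add ((hf.sub l.contDiff.contDiffOn).smul contDiffOn_const)
  have hfc : ∀ y ∈ s, ContDiffAt ℝ ∞ f y := fun y hy ↦ hf.contDiffAt (hs.mem_nhds hy)
  have hderiv : ∀ y ∈ s, HasFDerivAt Ψ₀
      (ContinuousLinearMap.id ℝ E + (fderiv ℝ f y - l).smulRight u) y := by
    intro y hy
    exact (hasFDerivAt_id y).add
      ((((hfc y hy).differentiableAt (by simp)).hasFDerivAt.sub l.hasFDerivAt).smul_const u)
  have hequiv : ∀ y, fderiv ℝ f y u ≠ 0 → ∃ A : E ≃L[ℝ] E, (A : E →L[ℝ] E) =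
      ContinuousLinearMap.id ℝ E + (fderiv ℝ f y - l).smulRight u := by
    intro y hy
    set B := ContinuousLinearMap.id ℝ E + (fderiv ℝ f y - l).smulRight u with hB
    have hinj : Function.Injective B.toLinearMap := by
      rw [← LinearMap.ker_eq_bot, LinearMap.ker_eq_bot']
      intro v hv
      have hv : v + (fderiv ℝ f y v - l v) • u = 0 := hv
      have h1 : fderiv ℝ f y v = 0 := by
        have := congrArg l hv
        simpa [hlu] using this
      have h2 : v = l v • u := by
        rw [h1] at hv
        simpa [add_neg_eq_zero] using hv
      have h3 : l v = 0 := by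
        rw [h2, map_smul, smul_eq_mul, mul_eq_zero] at h1
        exact h1.resolve_right hy
      rw [h2, h3, zero_smul]
    exact ⟨(LinearEquiv.ofInjectiveEndo _ hinj).toContinuousLinearEquiv, by ext; rfl⟩
  obtain ⟨A, hA⟩ := hequiv a hfu
  set Ψ₁ := (hΨc.contDiffAt (hs.mem_nhds ha)).toOpenPartialHomeomorph Ψ₀
    (f' := A) (hA ▸ hderiv a ha) (by simp) with hΨ₁
  have hfd : ContinuousOn (fun y ↦ fderiv ℝ f y u) s :=
    (hf.continuousOn_fderiv_of_isOpen hs (by simp)).clm_apply continuousOn_const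
  -- Membership in the groupoid needs a smooth inverse on the whole target, so the source is cut
  -- down to where the derivative is invertible.
  set t := s ∩ (fun y ↦ fderiv ℝ f y u) ⁻¹' {0}ᶜ with ht
  have hto : IsOpen t := hfd.isOpen_inter_preimage hs isOpen_compl_singleton
  set Ψ := Ψ₁.restrOpen t hto with hΨ
  have hΨsrc : Ψ.source ⊆ t := inter_subset_right
  have hcoe : ∀ y, Ψ y = Ψ₀ y := fun y ↦ rfl
  refine ⟨Ψ, ?_, ⟨ContDiffAt.mem_toOpenPartialHomeomorph_source _ _ _, ha, hfu⟩, fun y ↦ ?_⟩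
  · rw [contDiffGroupoid, mem_groupoid_of_pregroupoid]
    refine ⟨?_, ?_⟩
    · simp only [contDiffPregroupoid, modelWithCornersSelf_coe,
        modelWithCornersSelf_coe_symm, Function.comp_id, Function.id_comp, preimage_id, range_id,
        inter_univ]
      exact hΨc.mono fun y hy ↦ (hΨsrc hy).1
    · simp only [contDiffPregroupoid, modelWithCornersSelf_coe,
        modelWithCornersSelf_coe_symm, Function.comp_id, Function.id_comp, preimage_id, range_id,
        inter_univ]
      intro w hw
      have hw' := hΨsrc (Ψ.map_target hw)
      obtain ⟨B, hB⟩ := hequiv (Ψ.symm w) hw'.2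
      exact (Ψ.contDiffAt_symm (f₀' := B) hw (hB ▸ hderiv _ hw'.1)
        (hΨc.contDiffAt (hs.mem_nhds hw'.1))).contDiffWithinAt
  · rw [hcoe]
    simp [hΨ₀, hlu]

/-- Composing a chart with a local diffeomorphism of the model space yields a chart. -/
theorem trans_mem_maximalAtlas {H X : Type*} [TopologicalSpace H] [TopologicalSpace X]
    [ChartedSpace H X] {G : StructureGroupoid H} {c : OpenPartialHomeomorph X H}
    (hc : c ∈ G.maximalAtlas X) {Ψ : OpenPartialHomeomorph H H} (hΨ : Ψ ∈ G) :
    c.trans Ψ ∈ G.maximalAtlas X := by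
  rw [mem_maximalAtlas_iff] at hc ⊢
  intro e he
  constructor
  · rw [OpenPartialHomeomorph.trans_symm_eq_symm_trans_symm, OpenPartialHomeomorph.trans_assoc]
    exact G.trans (G.symm hΨ) (hc e he).1
  · rw [← OpenPartialHomeomorph.trans_assoc]
    exact G.trans (hc e he).2 hΨ

/-- The zero set of a smooth real function is an embedded hypersurface if the derivative does not
vanish there. -/
theorem isEmbeddedHypersurface_of_mfderiv_ne_zero {n : ℕ} {X : Type*} [TopologicalSpace X]
    [ChartedSpace (EuclideanSpace ℝ (Fin (n + 1))) X] [IsManifold (𝓡 (n + 1)) ∞ X]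
    {f : X → ℝ} (hf : ContMDiff (𝓡 (n + 1)) 𝓘(ℝ, ℝ) ∞ f)
    (hf' : ∀ x, f x = 0 → mfderiv (𝓡 (n + 1)) 𝓘(ℝ, ℝ) f x ≠ 0) :
    IsEmbeddedHypersurface n {x | f x = 0} := by
  intro x hx
  set c := chartAt (EuclideanSpace ℝ (Fin (n + 1))) x
  have hxc : x ∈ c.source := mem_chart_source _ x
  have hl : (EuclideanSpace.proj (𝕜 := ℝ) (Fin.last n) :
      EuclideanSpace ℝ (Fin (n + 1)) →L[ℝ] ℝ) ≠ 0 := by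
    intro h0
    have := DFunLike.congr_fun h0 (EuclideanSpace.single (Fin.last n) 1)
    simp at this
  obtain ⟨Ψ, hΨ, hxΨ, hΨf⟩ := exists_mem_contDiffGroupoid_apply_eq c.open_target
    (contDiffOn_comp_chartAt_symm hf x) (c.map_source hxc)
    (fun h0 ↦ hf' x hx ((mfderiv_eq_fderiv_comp_chartAt_symm hf x).trans h0)) hl
  refine ⟨c.trans Ψ, trans_mem_maximalAtlas (IsManifold.chart_mem_maximalAtlas x) hΨ,
    ?_, fun p hp ↦ ?_⟩
  · rw [OpenPartialHomeomorph.trans_source]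
    exact ⟨hxc, hxΨ⟩
  · rw [OpenPartialHomeomorph.trans_source] at hp
    have := hΨf (c p)
    rw [Function.comp_apply, c.left_inv hp.1] at this
    rw [mem_ofPred_eq, ← this]
    rfl

/-! ### Derivative along the fibres and the main theorem -/

/-- The derivative of a function of weight `m` along the generator of the action. -/
theorem mfderiv_apply_generator {n : ℕ}
    {M : Type*} [TopologicalSpace M] [ChartedSpace (EuclideanSpace ℝ (Fin n)) M]
    {X : Type*} [TopologicalSpace X] [ChartedSpace (EuclideanSpace ℝ (Fin (n + 1))) X]
    [IsManifold (𝓡 (n + 1)) ∞ X] [MulAction Circle X] {pr : X → M} (h : IsPrincipal n pr)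
    {m : ℤ} {φ : X → ℂ} (hφs : ContMDiff (𝓡 (n + 1)) 𝓘(ℝ, ℂ) ∞ φ)
    (hφ : ∀ (a : Circle) (x : X), φ (a • x) = (a : ℂ) ^ m * φ x) (x : X) :
    (mfderiv (𝓡 (n + 1)) 𝓘(ℝ, ℂ) φ x (generator n x) : ℂ) = (m : ℂ) * Complex.I * φ x := by
  have hγ : ContMDiff 𝓘(ℝ, ℝ) (𝓡 (n + 1)) ∞ (fun θ : ℝ ↦ Circle.exp θ • x) :=
    h.smooth_action.comp (contMDiff_circleExp.prodMk contMDiff_const)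
  have h0 : Circle.exp 0 • x = x := by simp
  have hcomp := mfderiv_comp_apply_of_eq (I := 𝓘(ℝ, ℝ)) (I' := 𝓡 (n + 1)) (I'' := 𝓘(ℝ, ℂ))
    (g := φ) (f := fun θ : ℝ ↦ Circle.exp θ • x) (x := 0) (y := x)
    ((hφs x).mdifferentiableAt (by simp)) ((hγ 0).mdifferentiableAt (by simp)) h0 (1 : ℝ)
  have hd : HasDerivAt (φ ∘ fun θ : ℝ ↦ Circle.exp θ • x) (m * Complex.I * φ x) 0 := by
    have heq : (φ ∘ fun θ : ℝ ↦ Circle.exp θ • x) =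
        fun θ : ℝ ↦ Complex.exp (m * Complex.I * θ) * φ x := by
      ext θ
      rw [Function.comp_apply, hφ, Circle.coe_exp, ← Complex.exp_int_mul]
      ring_nf
    rw [heq]
    have h1 : HasDerivAt (fun θ : ℝ ↦ m * Complex.I * (θ : ℂ)) (m * Complex.I) 0 := by
      simpa using (Complex.ofRealCLM.hasDerivAt (x := (0 : ℝ))).const_mul (m * Complex.I)
    simpa using h1.cexp.mul_const (φ x)
  unfold generator
  rw [← hcomp, mfderiv_eq_fderiv]
  exact (DFunLike.congr_fun hd.hasFDerivAt.fderiv 1).trans (one_smul ℝ _)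

end CircleBundle

open CircleBundle
theorem mainTheorem3 {n : ℕ}
    {M : Type*} [TopologicalSpace M] [T2Space M] [CompactSpace M] [ConnectedSpace M]
    [ChartedSpace (EuclideanSpace ℝ (Fin n)) M] [IsManifold (𝓡 n) ∞ M]
    {X : Type*} [TopologicalSpace X] [T2Space X]
    [ChartedSpace (EuclideanSpace ℝ (Fin (n + 1))) X] [IsManifold (𝓡 (n + 1)) ∞ X]
    [MulAction Circle X] (pr : X → M) (hpr : IsPrincipal n pr)
    (g : RMetric n M)
    (α : ∀ x : X, TangentSpace (𝓡 (n + 1)) x →L[ℝ] ℝ) (hα : IsConnectionForm α)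
    (N : ℝ) (hN : 0 < N)
    (G : RMetric (n + 1) X) (hG : IsBundleMetric pr N α g G)
    (m : ℤ) (hm : m ≠ 0)
    (φ : X → ℂ) (hφ : IsEquivariantEigenfunction G m φ)
    (hreg : ZeroIsRegularValue (n + 1) φ)
    (hzero : ∃ z₀ : M, assocSection hpr m φ z₀ = zeroLineSection hpr m z₀) :
    IsEmbeddedHypersurface n (nodalSet φ) ∧
      IsConnected (nodalSet φ) ∧
      Nat.card (ConnectedComponents ↥(nodalSet φ)ᶜ) = 2 := by
  have hφc : Continuous φ := hφ.smooth.continuous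
  obtain ⟨x₀, hx₀⟩ : ∃ x₀, φ x₀ = 0 := by
    obtain ⟨z₀, hz₀⟩ := hzero
    obtain ⟨a, -, ha⟩ := Quotient.exact hz₀
    exact ⟨_, (mul_eq_zero.1 ha).resolve_left (zpow_ne_zero _ a.coe_ne_zero)⟩
  have hcone : ∀ D : Set ℂ, Convex ℝ D → (∀ r : ℝ, 0 < r → ∀ w ∈ D, r • w ∈ D) →
      ∀ d ∈ D, d ≠ 0 → IsConnected (φ ⁻¹' D) := by
    intro D hDc hD d hd hd0
    refine hpr.isConnected_preimage_cone hm hφc hφ.equivariant hD hd hd0 (fun x hx ↦ ?_) hx₀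
    obtain ⟨h1, U, hU, hxU, hUD⟩ :=
      exists_isOpen_isPreconnected_inter_preimage hφ.smooth (hreg x hx)
    exact ⟨hx ▸ h1, U, hU, hxU, hUD D hDc⟩
  refine ⟨?_, ?_, ?_⟩
  · have hre : ContMDiff (𝓡 (n + 1)) 𝓘(ℝ, ℝ) ∞ (fun x ↦ (φ x).re) :=
      Complex.reCLM.contDiff.contMDiff.comp hφ.smooth
    refine isEmbeddedHypersurface_of_mfderiv_ne_zero hre fun x hx h0 ↦ ?_
    have hcomp : ∀ v : EuclideanSpace ℝ (Fin (n + 1)),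
        (mfderiv (𝓡 (n + 1)) 𝓘(ℝ, ℂ) φ x v : ℂ).re = 0 := by
      intro v
      have h1 := mfderiv_comp_apply (I := 𝓡 (n + 1)) (I' := 𝓘(ℝ, ℂ)) (I'' := 𝓘(ℝ, ℝ))
        (g := Complex.reCLM) (f := φ) x
        Complex.reCLM.differentiableAt.mdifferentiableAt
        ((hφ.smooth x).mdifferentiableAt (by simp)) v
      rw [mfderiv_eq_fderiv, ContinuousLinearMap.fderiv] at h1
      exact h1.symm.trans (DFunLike.congr_fun h0 v)
    by_cases hx0 : φ x = 0
    · obtain ⟨v, hv⟩ := hreg x hx0 (1 : ℂ)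
      have := hcomp v
      rw [hv] at this
      exact one_ne_zero this
    -- The real part of imφ is -m Im φ, so Re φ = 0 would force φ x = 0.
    · have := hcomp (generator n x)
      rw [mfderiv_apply_generator hpr hφ.smooth hφ.equivariant] at this
      have hx : (φ x).re = 0 := hx
      have him : (φ x).im = 0 := by simpa [hm, hx] using this
      exact hx0 (Complex.ext hx him)
  -- The cone need not be open: the imaginary axis is a line, and its preimage is the nodal set
  -- itself.
  · refine hcone {w | w.re = 0} ?_ ?_ Complex.I (by simp) Complex.I_ne_zero
    · exact convex_hyperplane (f := fun w : ℂ ↦ w.re) Complex.reLm.isLinear 0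
    · intro r _ w hw
      simp_all
  · refine card_connectedComponents_ne_zero (Complex.continuous_re.comp hφc) ?_ ?_
    · refine hcone {w | 0 < w.re} (convex_halfSpace_re_gt 0) ?_ 1 (by simp) one_ne_zero
      intro r hr w hw
      simpa using mul_pos hr hw
    · refine hcone {w | w.re < 0} (convex_halfSpace_re_lt 0) ?_ (-1) (by simp) (by simp)
      intro r hr w hw
      simpa using mul_neg_of_pos_of_neg hr hw
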